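/- Let $b\ge 2$ be an integer and $\omega_b=\exp(2\pi\sqrt{-1}/b)$. Write the $b$-adic expansion of a nonnegative integer $k$ as $k=\kappa_1b^{a_1-1}+\cdots+\kappa_vb^{a_v-1}$ with integers $0<\kappa_i\le b-1$ and $a_1>\cdots>a_v\ge 1$ (so $v=0$ for $k=0$), and put $v(k)=v$. For $n\ge 0$ let $k_{\le n}=\sum_{i=1}^{\min(n,v)}\kappa_ib^{a_i-1}$ and $k_{>n}=\sum_{i=n+1}^{v}\kappa_ib^{a_i-1}$. For $x\in[0,1)$ with $b$-adic expansion $x=\xi_1b^{-1}+\xi_2b^{-2}+\cdots$ in which infinitely many digits $\xi_i$ differ from $b-1$, let $\mathrm{wal}_k(x)=\omega_b^{\sum_{i=1}^v\kappa_i\xi_{a_i}}$. Define $W(k)\colon[0,1]\to\mathbb C$ recursively by $W(0)(x)=1$ and, for $k>0$, $$W(k)(x)=\int_0^x\overline{\mathrm{wal}_{\kappa_vb^{a_v-1}}(y)}\,W(k')(y)\,dy,\qquad k'=k-\kappa_vb^{a_v-1}.$$ For $\boldsymbol k=(k_1,\dots,k_s)$ a vector of nonnegative integers, let $\widehat f(\boldsymbol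 k)=\int_{[0,1)^s}f(\boldsymbol x)\,\overline{\prod_{j=1}^s\mathrm{wal}_{k_j}(x_j)}\,d\boldsymbol x$, and write $f^{(m_1,\dots,m_s)}=(\partial/\partial x_1)^{m_1}\cdots(\partial/\partial x_s)^{m_s}f$ (with one-sided derivatives at the boundary of the cube). **Theorem.** Let $\boldsymbol k=(k_1,\dots,k_s)$ and $(\alpha_1,\dots,\alpha_s)$ be vectors of nonnegative integers, and let $f\colon[0,1]^s\to\mathbb R$ have continuous mixed partial derivatives up to order $\alpha_j$ in each variable $x_j$, i.e. $f^{(m_1,\dots,m_s)}$ exists and is continuous on $[0,1]^s$ whenever $0\le m_j\le\alpha_j$ for all $j$. Let $n_j$ be integers with $0\le n_j\le\min(\alpha_j,v(k_j))$ for $1\le j\le s$. Then $$\widehat f(\boldsymbol k)=(-1)^{n_1+\cdots+n_s}\int_{[0,1)^s}f^{(n_1,\dots,n_s)}(\boldsymbol x)\prod_{j=1}^s\overline{\mathrm{wal}_{(k_j)_{>n_j}}(x_j)}\,W\big((k_j)_{\le n_j}\big)(x_j)\,d\boldsymbol x.$$ -/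

import Mathlib

open scoped ComplexConjugate

namespace Walsh

/-- The coefficient of `b ^ i` in the `b`-adic expansion of the nonnegative integer `k`. -/
def digit (b k i : ℕ) : ℕ := (Nat.digits b k).getD i 0

/-- For `k = κ₁ b ^ (a₁ - 1) + ⋯ + κᵥ b ^ (aᵥ - 1)` with `0 < κᵢ < b` and `a₁ > ⋯ > aᵥ ≥ 1`, the
list `[a₁ - 1, …, aᵥ - 1]` of the positions of the nonzero `b`-adic digits of `k`, in decreasing
order; it is empty for `k = 0`. -/
def positions (b k : ℕ) : List ℕ :=
  ((List.range (Nat.digits b k).length).filter (fun i => digit b k i ≠ 0)).reverse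

/-- The Hamming weight `v(k) = v`: the number of nonzero `b`-adic digits of `k`. -/
def weight (b k : ℕ) : ℕ := (positions b k).length

/-- The list `[κ₁ b ^ (a₁ - 1), …, κᵥ b ^ (aᵥ - 1)]` of the nonzero terms of the `b`-adic
expansion of `k`, in decreasing order. -/
def terms (b k : ℕ) : List ℕ := (positions b k).map (fun i => digit b k i * b ^ i)

/-- `k_{≤ n}`, the sum of the first `min (n, v)` terms of the expansion of `k`. -/
def leadPart (b n k : ℕ) : ℕ := ((terms b k).take n).sum

/-- `k_{> n}`, the sum of the terms with index `n + 1, …, v` of the expansion of `k`. -/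
def tailPart (b n k : ℕ) : ℕ := ((terms b k).drop n).sum

/-- `κᵥ b ^ (aᵥ - 1)`, the smallest term of the expansion of `k`; only used for `k > 0`. -/
def lastTerm (b k : ℕ) : ℕ := (terms b k).getLastD 0

theorem lastTerm_pos (b : ℕ) [NeZero b] {k : ℕ} (hk : k ≠ 0) : 0 < lastTerm b k := by
  have hne : Nat.digits b k ≠ [] := Nat.digits_ne_nil_iff_ne_zero.mpr hk
  have hlast := Nat.getLast_digit_ne_zero b hk
  have hlen : 0 < (Nat.digits b k).length := List.length_pos_iff.mpr hne
  have hmem : (Nat.digits b k).length - 1 ∈ positions b k := by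
    have hd : digit b k ((Nat.digits b k).length - 1) ≠ 0 := by
      rw [List.getLast_eq_getElem] at hlast
      rwa [digit, List.getD_eq_getElem _ _ (by omega)]
    rw [positions, List.mem_reverse, List.mem_filter]
    exact ⟨List.mem_range.mpr (by omega), by simpa using hd⟩
  have hT : terms b k ≠ [] := by
    simpa [terms] using List.ne_nil_of_mem hmem
  have hin : lastTerm b k ∈ terms b k := by
    rw [lastTerm, List.getLastD_eq_getLast?, List.getLast?_eq_some_getLast hT]
    exact List.getLast_mem hT
  obtain ⟨i, hi, hi'⟩ := List.mem_map.mp hin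
  rw [← hi']
  rw [positions, List.mem_reverse, List.mem_filter] at hi
  have h0 : digit b k i ≠ 0 := by simpa using hi.2
  exact Nat.mul_pos (Nat.pos_of_ne_zero h0) (pow_pos (Nat.pos_of_ne_zero (NeZero.ne b)) i)

/-- The `b`-adic Walsh function `wal_k (x) = ω_b ^ (∑ᵢ κᵢ ξ_{aᵢ})` with `ω_b = exp (2 π i / b)`,
where `x = ξ₁ b⁻¹ + ξ₂ b⁻² + ⋯` in `[0, 1)` has infinitely many digits different from `b - 1`.
`Real.digits x b i` is the digit `ξ_{i + 1}`. -/
noncomputable def wal (b : ℕ) [NeZero b] (k : ℕ) (x : ℝ) : ℂ :=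
  Complex.exp (2 * Real.pi * Complex.I / b) ^
    ((positions b k).map (fun i => digit b k i * (Real.digits x b i : ℕ))).sum

/-- The function `W(k)(x)`: `W(0)(x) = 1`, and for `k > 0`
`W(k)(x) = ∫₀ˣ conj (wal_{κᵥ b ^ (aᵥ - 1)} (y)) W(k')(y) dy` with `k' = k - κᵥ b ^ (aᵥ - 1)`. -/
noncomputable def W (b : ℕ) [NeZero b] (k : ℕ) (x : ℝ) : ℂ :=
  if h : k = 0 then 1
  else ∫ y in (0 : ℝ)..x, conj (wal b (lastTerm b k) y) * W b (k - lastTerm b k) y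
termination_by k
decreasing_by exact Nat.sub_lt (Nat.pos_of_ne_zero h) (lastTerm_pos b h)

/-- The closed unit cube `[0, 1]^s`. -/
def closedCube (s : ℕ) : Set (Fin s → ℝ) := Set.univ.pi fun _ => Set.Icc 0 1

/-- The half-open unit cube `[0, 1)^s`. -/
def cube (s : ℕ) : Set (Fin s → ℝ) := Set.univ.pi fun _ => Set.Ico 0 1

/-- The multivariate Walsh function `∏ⱼ wal_{kⱼ} (xⱼ)`. -/
noncomputable def walMulti (b : ℕ) [NeZero b] {s : ℕ} (k : Fin s → ℕ) (x : Fin s → ℝ) : ℂ :=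
  ∏ j, wal b (k j) (x j)

/-- The `k`-th Walsh coefficient of `f`. -/
noncomputable def coeff (b : ℕ) [NeZero b] {s : ℕ} (f : (Fin s → ℝ) → ℂ) (k : Fin s → ℕ) : ℂ :=
  ∫ x in cube s, f x * conj (walMulti b k x)

/-- The partial derivative `∂g/∂xⱼ` of a function on `[0, 1]^s` (one-sided on the faces). On the
closed cube it depends only on the values of `g` there. -/
noncomputable def partialDeriv {s : ℕ} (j : Fin s) (g : (Fin s → ℝ) → ℝ) (x : Fin s → ℝ) : ℝ :=
  derivWithin (fun t => g (Function.update x j t)) (Set.Icc 0 1) (x j)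

/-- `f^{(n₁, …, n_s)} = (∂/∂x₁)^{n₁} ⋯ (∂/∂x_s)^{n_s} f`. -/
noncomputable def mixedDeriv {s : ℕ} (n : Fin s → ℕ) (f : (Fin s → ℝ) → ℝ) :
    (Fin s → ℝ) → ℝ :=
  (List.finRange s).foldr (fun j g => (partialDeriv j)^[n j] g) f

/-- `f : [0, 1]^s → ℝ` has continuous mixed partial derivatives up to order `αⱼ` in each variable
`xⱼ`: for all `mⱼ ≤ αⱼ` the derivative `f^{(m₁, …, m_s)}` exists and is continuous on `[0, 1]^s`.
In `exists_deriv`, if `mᵢ = 0` for `i < j`, then `∂/∂xⱼ` is the next derivative to be taken in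
`(∂/∂x₁)^{⋯} ⋯ (∂/∂xⱼ)^{mⱼ + 1} (∂/∂x_{j+1})^{m_{j+1}} ⋯ (∂/∂x_s)^{m_s} f`; the condition says
that each of these successive one-variable derivatives exists. -/
structure HasContMixedDerivs {s : ℕ} (α : Fin s → ℕ) (f : (Fin s → ℝ) → ℝ) : Prop where
  exists_deriv : ∀ (m : Fin s → ℕ) (j : Fin s), (∀ i, m i ≤ α i) → (∀ i < j, m i = 0) →
    m j < α j → ∀ x ∈ closedCube s,
      DifferentiableWithinAt ℝ (fun t => mixedDeriv m f (Function.update x j t))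
        (Set.Icc 0 1) (x j)
  continuousOn : ∀ m : Fin s → ℕ, (∀ i, m i ≤ α i) →
    ContinuousOn (mixedDeriv m f) (closedCube s)

end Walsh

namespace Walsh

/-! The formula is integration by parts, one derivative at a time. Let `p` be the position of the
`(n+1)`-st nonzero digit `κ` of `k`. The key fact (`integral_wal_mul_W`) is that on `[0, ∞)` the
primitive from `0` of `conj wal_{k_{> n}} * W (k_{≤ n})` is `conj wal_{k_{> n + 1}} * W (k_{≤ n +
1})`.

For this, factor `wal_{k_{> n}} = wal_{κ b ^ p} * wal_{k_{> n + 1}}`. The second factor has digit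
positions below `p`, so it is constant on elementary intervals of length `b ^ (-p)` and can be
pulled out there. The pieces fit together because `W (k_{≤ n + 1})` vanishes on the grid `b ^ (-p)
ℕ`: its integrand is periodic with period `b ^ (-p)`, and it has mean zero because a shift by `b ^
(-(p + 1))` fixes `W (k_{≤ n})` and multiplies `conj wal_{κ b ^ p}` by a root of unity other than
`1`.

Since `0` and `1` lie on this grid, the boundary terms vanish and each step contributes only a sign.
In several variables, Fubini's theorem isolates one variable (`setIntegral_mixedDeriv_mul`), and
induction on the total order of differentiation finishes. -/

/-! ### Digits of partial sums of the expansion -/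

theorem mem_positions {b k i : ℕ} : i ∈ positions b k ↔ digit b k i ≠ 0 := by
  simp only [positions, List.mem_reverse, List.mem_filter, List.mem_range, decide_eq_true_eq,
    and_iff_right_iff_imp]
  intro h
  by_contra hi
  exact h (List.getD_eq_default _ _ (not_lt.mp hi))

theorem positions_pairwise (b k : ℕ) : (positions b k).Pairwise (· > ·) := by
  rw [positions, List.pairwise_reverse]
  exact List.pairwise_lt_range.filter _

theorem digit_lt {b : ℕ} (hb : 2 ≤ b) (k i : ℕ) : digit b k i < b := by
  rw [digit, Nat.getD_digits _ _ hb]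
  exact Nat.mod_lt _ (by omega)

theorem sum_map_mul_pow_lt {b : ℕ} {d : ℕ → ℕ} (hd : ∀ i, d i < b) {L : List ℕ}
    (hL : L.Pairwise (· > ·)) {p : ℕ} (hp : ∀ i ∈ L, i < p) :
    (L.map fun i => d i * b ^ i).sum < b ^ p := by
  have hb : 0 < b := (Nat.zero_le _).trans_lt (hd 0)
  induction L generalizing p with
  | nil => simpa using Nat.pow_pos hb
  | cons q L ih =>
    rw [List.pairwise_cons] at hL
    have h1 := ih hL.2 hL.1
    have h2 : (d q + 1) * b ^ q ≤ b ^ (q + 1) := by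
      rw [pow_succ']
      exact Nat.mul_le_mul_right _ (hd q)
    have h3 : b ^ (q + 1) ≤ b ^ p := Nat.pow_le_pow_right hb (hp q (by simp))
    simp only [List.map_cons, List.sum_cons]
    linarith

theorem digit_sum_map {b : ℕ} (hb : 2 ≤ b) {d : ℕ → ℕ} (hd : ∀ i, d i < b) {L : List ℕ}
    (hL : L.Pairwise (· > ·)) (j : ℕ) :
    digit b (L.map fun i => d i * b ^ i).sum j = if j ∈ L then d j else 0 := by
  rw [digit, Nat.getD_digits _ _ hb]
  induction L with
  | nil => simp
  | cons p L ih =>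
    have hlt := sum_map_mul_pow_lt hd hL (p := p + 1) (by
      intro i hi
      rcases List.mem_cons.mp hi with rfl | hi
      · omega
      · exact Nat.lt_succ_of_lt ((List.pairwise_cons.mp hL).1 i hi))
    rw [List.pairwise_cons] at hL
    have hlt' := sum_map_mul_pow_lt hd hL.2 hL.1
    have ih := ih hL.2
    simp only [List.map_cons, List.sum_cons] at hlt ⊢
    set S := (L.map fun i => d i * b ^ i).sum
    have hbpos : 0 < b := by omega
    rcases lt_trichotomy j p with h | rfl | h
    · have : d p * b ^ p + S = S + b ^ j * (b * (d p * b ^ (p - 1 - j))) := by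
        have : b ^ p = b ^ j * b * b ^ (p - 1 - j) := by
          rw [← pow_succ, ← pow_add]
          congr 1
          omega
        rw [this]
        ring
      rw [this, Nat.add_mul_div_left _ _ (Nat.pow_pos hbpos), Nat.add_mul_mod_self_left, ih]
      simp [List.mem_cons, h.ne]
    · rw [add_comm, Nat.add_mul_div_right _ _ (Nat.pow_pos hbpos), Nat.div_eq_of_lt hlt', zero_add,
        Nat.mod_eq_of_lt (hd j)]
      simp
    · have hj : j ∉ p :: L := by
        intro hm
        rcases List.mem_cons.mp hm with rfl | hm
        · exact lt_irrefl _ h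
        · exact lt_asymm h (hL.1 j hm)
      rw [Nat.div_eq_of_lt (hlt.trans_le (Nat.pow_le_pow_right hbpos h)), if_neg hj, Nat.zero_mod]

/-- Sublists treat `k_{≤ n}`, `k_{> n}` and single terms uniformly. Both sides are strictly
decreasing lists, so equality of their members suffices. -/
theorem positions_sum_map {b k : ℕ} (hb : 2 ≤ b) {L : List ℕ} (hL : L.Sublist (positions b k)) :
    positions b (L.map fun i => digit b k i * b ^ i).sum = L := by
  have hP := (positions_pairwise b k).sublist hL
  refine (positions_pairwise b _).eq_of_mem_iff hP fun i => ?_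
  rw [mem_positions, digit_sum_map hb (digit_lt hb k) hP]
  constructor
  · intro h
    by_contra hi
    exact h (if_neg hi)
  · intro h
    rw [if_pos h]
    exact mem_positions.mp (hL.subset h)

theorem digit_sum_map_of_mem {b k : ℕ} (hb : 2 ≤ b) {L : List ℕ} (hL : L.Sublist (positions b k))
    {i : ℕ} (hi : i ∈ L) :
    digit b (L.map fun i => digit b k i * b ^ i).sum i = digit b k i := by
  rw [digit_sum_map hb (digit_lt hb k) ((positions_pairwise b k).sublist hL), if_pos hi]

theorem terms_sum_map {b k : ℕ} (hb : 2 ≤ b) {L : List ℕ} (hL : L.Sublist (positions b k)) :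
    terms b (L.map fun i => digit b k i * b ^ i).sum = L.map fun i => digit b k i * b ^ i := by
  rw [terms, positions_sum_map hb hL]
  refine List.map_congr_left fun i hi => ?_
  rw [digit_sum_map_of_mem hb hL hi]

/-- The Walsh function of the part of `k` whose digits have positions in `L`. -/
noncomputable def partialWal (b : ℕ) [NeZero b] (k : ℕ) (L : List ℕ) (x : ℝ) : ℂ :=
  Complex.exp (2 * Real.pi * Complex.I / b) ^
    (L.map (fun i => digit b k i * (Real.digits x b i : ℕ))).sum

theorem wal_sum_map {b : ℕ} [NeZero b] (hb : 2 ≤ b) {k : ℕ} {L : List ℕ}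
    (hL : L.Sublist (positions b k)) (x : ℝ) :
    wal b (L.map fun i => digit b k i * b ^ i).sum x = partialWal b k L x := by
  rw [wal, partialWal, positions_sum_map hb hL]
  congr 2
  refine List.map_congr_left fun i hi => ?_
  rw [digit_sum_map_of_mem hb hL hi]

theorem partialWal_cons (b : ℕ) [NeZero b] (k p : ℕ) (L : List ℕ) (x : ℝ) :
    partialWal b k (p :: L) x = partialWal b k [p] x * partialWal b k L x := by
  simp [partialWal, pow_add]

theorem leadPart_eq (b n k : ℕ) :
    leadPart b n k = (((positions b k).take n).map fun i => digit b k i * b ^ i).sum := by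
  rw [leadPart, terms, List.map_take]

theorem tailPart_eq (b n k : ℕ) :
    tailPart b n k = (((positions b k).drop n).map fun i => digit b k i * b ^ i).sum := by
  rw [tailPart, terms, List.map_drop]

theorem wal_tailPart {b : ℕ} [NeZero b] (hb : 2 ≤ b) (n k : ℕ) (x : ℝ) :
    wal b (tailPart b n k) x = partialWal b k ((positions b k).drop n) x := by
  rw [tailPart_eq, wal_sum_map hb (List.drop_sublist _ _)]

theorem wal_tailPart_zero {b : ℕ} [NeZero b] (hb : 2 ≤ b) (k : ℕ) (x : ℝ) :
    wal b (tailPart b 0 k) x = wal b k x := by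
  rw [wal_tailPart hb, List.drop_zero, partialWal, wal]

theorem W_leadPart_zero (b : ℕ) [NeZero b] (k : ℕ) (x : ℝ) : W b (leadPart b 0 k) x = 1 := by
  rw [W, dif_pos (by simp [leadPart])]

theorem W_leadPart_succ {b : ℕ} [NeZero b] (hb : 2 ≤ b) {n k : ℕ} (hn : n < (positions b k).length)
    (x : ℝ) :
    W b (leadPart b (n + 1) k) x =
      ∫ y in (0 : ℝ)..x, conj (partialWal b k [(positions b k)[n]] y) * W b (leadPart b n k) y := by
  set p := (positions b k)[n] with hp
  have htake : (positions b k).take (n + 1) = (positions b k).take n ++ [p] := by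
    rw [List.take_succ_eq_append_getElem hn]
  have hlast : lastTerm b (leadPart b (n + 1) k) = digit b k p * b ^ p := by
    rw [lastTerm, leadPart_eq, terms_sum_map hb (List.take_sublist _ _), htake]
    simp
  have hadd : leadPart b (n + 1) k = leadPart b n k + digit b k p * b ^ p := by
    rw [leadPart_eq, leadPart_eq, htake]
    simp
  have hpos : 0 < digit b k p * b ^ p :=
    Nat.mul_pos (Nat.pos_of_ne_zero (mem_positions.mp (List.getElem_mem hn)))
      (Nat.pow_pos (by omega))
  have hwal : ∀ y, wal b (digit b k p * b ^ p) y = partialWal b k [p] y := by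
    intro y
    rw [← wal_sum_map hb (List.singleton_sublist.mpr (List.getElem_mem hn))]
    simp [hp]
  rw [W, dif_neg (by omega), hlast]
  simp only [hwal]
  rw [hadd, Nat.add_sub_cancel]

open MeasureTheory Set Filter Topology

/-! ### Regularity and shifts of Walsh functions -/

section

variable {b : ℕ} [NeZero b]

theorem val_digits (x : ℝ) (i : ℕ) : (Real.digits x b i : ℕ) = ⌊x * b ^ (i + 1)⌋₊ % b := by
  simp [Real.digits]

theorem norm_partialWal (k : ℕ) (L : List ℕ) (x : ℝ) : ‖partialWal b k L x‖ = 1 := by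
  have h : 2 * Real.pi * Complex.I / b = ((2 * Real.pi / b : ℝ) : ℂ) * Complex.I := by
    push_cast
    ring
  rw [partialWal, norm_pow, h, Complex.norm_exp_ofReal_mul_I, one_pow]

theorem measurable_partialWal (k : ℕ) (L : List ℕ) : Measurable (partialWal b k L) := by
  have hd : ∀ i, Measurable fun x : ℝ => (Real.digits x b i : ℕ) := by
    intro i
    simp only [val_digits]
    exact (measurable_from_nat (f := fun m => m % b)).comp
      (Nat.measurable_floor.comp (measurable_id.mul_const _))
  have hs : Measurable fun x : ℝ =>
      (L.map (fun i => digit b k i * (Real.digits x b i : ℕ))).sum := by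
    induction L with
    | nil => simp
    | cons p L ih =>
      simp only [List.map_cons, List.sum_cons]
      exact ((hd p).const_mul _).add ih
  exact (measurable_from_nat (f := fun m => Complex.exp (2 * Real.pi * Complex.I / b) ^ m)).comp hs

theorem intervalIntegrable_mul_of_norm_le_one {e V : ℝ → ℂ} (he : Measurable e)
    (he1 : ∀ x, ‖e x‖ ≤ 1) (hV : Continuous V) (u v : ℝ) :
    IntervalIntegrable (fun x => e x * V x) volume u v := by
  have h := hV.intervalIntegrable (μ := volume) u v
  exact ⟨h.1.bdd_mul he.aestronglyMeasurable (ae_of_all _ he1),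
    h.2.bdd_mul he.aestronglyMeasurable (ae_of_all _ he1)⟩

theorem measurable_conj_partialWal (k : ℕ) (L : List ℕ) :
    Measurable fun x => conj (partialWal b k L x) :=
  Complex.continuous_conj.measurable.comp (measurable_partialWal k L)

theorem norm_conj_partialWal_le (k : ℕ) (L : List ℕ) (x : ℝ) :
    ‖conj (partialWal b k L x)‖ ≤ 1 := by
  rw [RCLike.norm_conj, norm_partialWal]

theorem continuous_W_leadPart (hb : 2 ≤ b) {n k : ℕ} (hn : n ≤ (positions b k).length) :
    Continuous (W b (leadPart b n k)) := by
  induction n with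
  | zero =>
    simp only [funext (W_leadPart_zero b k)]
    exact continuous_const
  | succ n ih =>
    rw [funext (W_leadPart_succ hb hn)]
    exact intervalIntegral.continuous_primitive (intervalIntegrable_mul_of_norm_le_one
      (measurable_conj_partialWal k _) (norm_conj_partialWal_le k _) (ih (by omega))) 0

theorem partialWal_congr {k : ℕ} {L : List ℕ} {x y : ℝ}
    (h : ∀ i ∈ L, (Real.digits x b i : ℕ) = Real.digits y b i) :
    partialWal b k L x = partialWal b k L y := by
  rw [partialWal, partialWal]
  congr 2
  exact List.map_congr_left fun i hi => by rw [h i hi]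

/-- Digits are read off from floors, which are right-continuous; at `b`-adic points they jump from
the left. -/
theorem digits_eventually_eq (hb : 0 < b) (i : ℕ) {x : ℝ} (hx : 0 ≤ x) :
    ∀ᶠ y in 𝓝[≥] x, (Real.digits y b i : ℕ) = Real.digits x b i := by
  have hB : (0 : ℝ) < (b : ℝ) ^ (i + 1) := by positivity
  have hlt : ∀ᶠ y in 𝓝[≥] x, y * (b : ℝ) ^ (i + 1) < ⌊x * (b : ℝ) ^ (i + 1)⌋₊ + 1 :=
    nhdsWithin_le_nhds ((continuous_id.mul continuous_const).continuousAt.eventually_lt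
      continuousAt_const (Nat.lt_floor_add_one _))
  filter_upwards [hlt, self_mem_nhdsWithin] with y hy hxy
  rw [val_digits, val_digits]
  congr 1
  have hxy : x ≤ y := hxy
  rw [Nat.floor_eq_iff (mul_nonneg (hx.trans hxy) hB.le)]
  exact ⟨(Nat.floor_le (by positivity)).trans (by gcongr), hy⟩

theorem partialWal_continuousWithinAt (hb : 0 < b) (k : ℕ) (L : List ℕ) {x : ℝ} (hx : 0 ≤ x) :
    ContinuousWithinAt (partialWal b k L) (Ici x) x := by
  have h : ∀ᶠ y in 𝓝[≥] x, ∀ i ∈ L, (Real.digits y b i : ℕ) = Real.digits x b i := by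
    induction L with
    | nil => simp
    | cons p L ih =>
      filter_upwards [digits_eventually_eq hb p hx, ih] with y h1 h2
      exact List.forall_mem_cons.mpr ⟨h1, h2⟩
  exact continuousWithinAt_const.congr_of_eventuallyEq
    (h.mono fun y hy => partialWal_congr hy) rfl

/-- The Walsh functions with digit positions below `p` are constant on elementary intervals of
length `b ^ (-p)`. -/
theorem partialWal_eq_of_floor_eq (hb : 0 < b) {k p : ℕ} {L : List ℕ} (hL : ∀ i ∈ L, i < p)
    {x y : ℝ} (h : ⌊x * b ^ p⌋₊ = ⌊y * b ^ p⌋₊) : partialWal b k L x = partialWal b k L y := by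
  have hbR : (b : ℝ) ≠ 0 := by positivity
  have key : ∀ i < p, ∀ z : ℝ, ⌊z * b ^ (i + 1)⌋₊ = ⌊z * b ^ p⌋₊ / b ^ (p - (i + 1)) := by
    intro i hi z
    rw [← Nat.floor_div_natCast]
    congr 1
    have : (b : ℝ) ^ p = b ^ (i + 1) * b ^ (p - (i + 1)) := by
      rw [← pow_add]
      congr 1
      omega
    rw [this]
    push_cast
    field_simp
  refine partialWal_congr fun i hi => ?_
  rw [val_digits, val_digits, key i (hL i hi), key i (hL i hi), h]

/-- The shift raises the floor defining the digit by exactly one. The wrap-around modulo `b` is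
harmless because `ω_b ^ b = 1`. -/
theorem partialWal_singleton_add (hb : 0 < b) (k p : ℕ) {x : ℝ} (hx : 0 ≤ x) :
    partialWal b k [p] (x + 1 / b ^ (p + 1)) =
      Complex.exp (2 * Real.pi * Complex.I / b) ^ digit b k p * partialWal b k [p] x := by
  have hbR : (b : ℝ) ≠ 0 := by positivity
  have hfl : ⌊(x + 1 / b ^ (p + 1)) * (b : ℝ) ^ (p + 1)⌋₊ = ⌊x * (b : ℝ) ^ (p + 1)⌋₊ + 1 := by
    rw [add_mul, one_div, inv_mul_cancel₀ (by positivity), Nat.floor_add_one (by positivity)]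
  have hζ := (Complex.isPrimitiveRoot_exp b (NeZero.ne b)).pow_eq_one
  simp only [partialWal, List.map_cons, List.map_nil, List.sum_cons, List.sum_nil, add_zero,
    val_digits, hfl]
  set ζ := Complex.exp (2 * Real.pi * Complex.I / b)
  rw [mul_comm (digit b k p), mul_comm (digit b k p), pow_mul, pow_mul, ← pow_eq_pow_mod _ hζ,
    ← pow_eq_pow_mod _ hζ, ← mul_pow, ← pow_succ']

theorem exp_pow_digit_ne_one (hb : 2 ≤ b) {k p : ℕ} (hp : digit b k p ≠ 0) :
    Complex.exp (2 * Real.pi * Complex.I / b) ^ digit b k p ≠ 1 := fun h =>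
  hp (Nat.eq_zero_of_dvd_of_lt
    ((Complex.isPrimitiveRoot_exp b (NeZero.ne b)).dvd_of_pow_eq_one _ h) (digit_lt hb k p))

/-! ### Periodicity and zeros of `W` -/

theorem add_nat_mul_of_add {E : Type*} {f : ℝ → E} {δ : ℝ} (hδ : 0 ≤ δ)
    (hf : ∀ x, 0 ≤ x → f (x + δ) = f x) (m : ℕ) {x : ℝ} (hx : 0 ≤ x) : f (x + m * δ) = f x := by
  induction m with
  | zero => simp
  | succ m ih =>
    rw [← ih, ← hf (x + m * δ) (by positivity)]
    congr 1
    push_cast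
    ring

/-- A function with `f (x + δ) = z * f x` for `x ≥ 0`, where `z ≠ 1`, that is periodic with period
`h` on `[0, ∞)`, has mean zero over the period. -/
theorem integral_eq_zero_of_add_eq_mul {f : ℝ → ℂ} {z : ℂ} (hz : z ≠ 1) {δ h : ℝ} (hδ : 0 ≤ δ)
    (hh : 0 ≤ h) (hint : ∀ u v, IntervalIntegrable f volume u v)
    (hfδ : ∀ x, 0 ≤ x → f (x + δ) = z * f x) (hfh : ∀ x, 0 ≤ x → f (x + h) = f x) :
    ∫ x in (0 : ℝ)..h, f x = 0 := by
  have h1 : ∫ x in δ..(h + δ), f x = z * ∫ x in (0 : ℝ)..h, f x := by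
    rw [← intervalIntegral.integral_const_mul]
    have := intervalIntegral.integral_comp_add_right (a := 0) (b := h) f δ
    rw [zero_add] at this
    rw [← this]
    refine intervalIntegral.integral_congr fun x hx => ?_
    rw [uIcc_of_le hh] at hx
    exact hfδ x hx.1
  have h2 : ∫ x in h..(h + δ), f x = ∫ x in (0 : ℝ)..δ, f x := by
    have := intervalIntegral.integral_comp_add_right (a := 0) (b := δ) f h
    rw [zero_add, add_comm δ h] at this
    rw [← this]
    refine intervalIntegral.integral_congr fun x hx => ?_
    rw [uIcc_of_le hδ] at hx
    exact hfh x hx.1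
  -- Splitting the integral over `[0, h + δ]` at `δ` and at `h` gives `z * I = I` for the integral
  -- `I` over `[0, h]`.
  have h3 := intervalIntegral.integral_add_adjacent_intervals (hint 0 δ) (hint δ (h + δ))
  have h4 := intervalIntegral.integral_add_adjacent_intervals (hint 0 h) (hint h (h + δ))
  rw [h1] at h3
  rw [h2, ← h3] at h4
  have h5 : (z - 1) * ∫ x in (0 : ℝ)..h, f x = 0 := by linear_combination -h4
  exact (mul_eq_zero.mp h5).resolve_left (sub_ne_zero.mpr hz)

/-- The integral of a periodic function with mean zero is periodic. -/
theorem integral_add_period {f : ℝ → ℂ} {h : ℝ} (hint : ∀ u v, IntervalIntegrable f volume u v)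
    (hfh : ∀ x, 0 ≤ x → f (x + h) = f x) (h0 : ∫ x in (0 : ℝ)..h, f x = 0) {x : ℝ} (hx : 0 ≤ x) :
    ∫ y in (0 : ℝ)..(x + h), f y = ∫ y in (0 : ℝ)..x, f y := by
  rw [← intervalIntegral.integral_add_adjacent_intervals (hint 0 h) (hint h (x + h)), h0, zero_add]
  have := intervalIntegral.integral_comp_add_right (a := 0) (b := x) f h
  rw [zero_add] at this
  rw [← this]
  refine intervalIntegral.integral_congr fun y hy => ?_
  rw [uIcc_of_le hx] at hy
  exact hfh y hy.1

theorem intervalIntegrable_conj_partialWal_mul_W (hb : 2 ≤ b) {n k : ℕ}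
    (hn : n ≤ (positions b k).length) (L : List ℕ) (u v : ℝ) :
    IntervalIntegrable (fun y => conj (partialWal b k L y) * W b (leadPart b n k) y) volume u v :=
  intervalIntegrable_mul_of_norm_le_one (measurable_conj_partialWal k L)
    (norm_conj_partialWal_le k L) (continuous_W_leadPart hb hn) u v

/-- If `W (k_{≤ n})` has the period `b ^ (-a)`, where `a - 1` is the next digit position, then
`W (k_{≤ n + 1})` has the period `b ^ (1 - a)`. -/
theorem W_leadPart_succ_add (hb : 2 ≤ b) {n k : ℕ} (hn : n < (positions b k).length)
    (hper : ∀ x : ℝ, 0 ≤ x → W b (leadPart b n k) (x + 1 / b ^ ((positions b k)[n] + 1)) =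
      W b (leadPart b n k) x) {x : ℝ} (hx : 0 ≤ x) :
    W b (leadPart b (n + 1) k) (x + 1 / b ^ (positions b k)[n]) = W b (leadPart b (n + 1) k) x := by
  rw [W_leadPart_succ hb hn, W_leadPart_succ hb hn]
  set p := (positions b k)[n] with hp
  have hb0 : 0 < b := by omega
  have hbR : (b : ℝ) ≠ 0 := by positivity
  have hdig : digit b k p ≠ 0 := mem_positions.mp (List.getElem_mem hn)
  set ζ := Complex.exp (2 * Real.pi * Complex.I / b) with hζ
  have hδ : ∀ x : ℝ, 0 ≤ x → conj (partialWal b k [p] (x + 1 / b ^ (p + 1))) *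
      W b (leadPart b n k) (x + 1 / b ^ (p + 1)) =
      conj (ζ ^ digit b k p) * (conj (partialWal b k [p] x) * W b (leadPart b n k) x) := by
    intro x hx
    rw [hper x hx, partialWal_singleton_add hb0 k p hx, map_mul, mul_assoc]
  have hperiod : (1 : ℝ) / b ^ p = b * (1 / b ^ (p + 1)) := by
    rw [pow_succ]
    field_simp
  -- The longer shift is `b` shorter ones, and their combined factor is `(ζ ^ κ) ^ b = 1`.
  have hh : ∀ x : ℝ, 0 ≤ x → conj (partialWal b k [p] (x + 1 / b ^ p)) *
      W b (leadPart b n k) (x + 1 / b ^ p) =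
      conj (partialWal b k [p] x) * W b (leadPart b n k) x := by
    intro x hx
    rw [hperiod, add_nat_mul_of_add (by positivity) hper b hx]
    congr 2
    have : ∀ m : ℕ, partialWal b k [p] (x + m * (1 / b ^ (p + 1))) =
        (ζ ^ digit b k p) ^ m * partialWal b k [p] x := by
      intro m
      induction m with
      | zero => simp
      | succ m ih =>
        rw [pow_succ' (ζ ^ digit b k p), mul_assoc, ← ih,
          ← partialWal_singleton_add hb0 k p (by positivity)]
        congr 1
        push_cast
        ring
    rw [this, ← pow_mul, mul_comm (digit b k p), pow_mul,
      (Complex.isPrimitiveRoot_exp b (NeZero.ne b)).pow_eq_one, one_pow, one_mul]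
  have hint := intervalIntegrable_conj_partialWal_mul_W hb hn.le [p]
  refine integral_add_period hint hh (integral_eq_zero_of_add_eq_mul ?_ ?_ ?_ hint hδ hh) hx
  · rw [Ne, ← map_one (starRingEnd ℂ), (starRingEnd ℂ).injective.eq_iff]
    exact exp_pow_digit_ne_one hb hdig
  · positivity
  · positivity

/-- Positions strictly decrease, so the period required at the next position is a whole multiple of
the one just obtained. -/
theorem W_leadPart_add (hb : 2 ≤ b) {n k : ℕ} (hn : n < (positions b k).length) {x : ℝ}
    (hx : 0 ≤ x) :
    W b (leadPart b n k) (x + 1 / b ^ ((positions b k)[n] + 1)) = W b (leadPart b n k) x := by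
  induction n generalizing x with
  | zero => rw [W_leadPart_zero, W_leadPart_zero]
  | succ n ih =>
    have hn' : n < (positions b k).length := by omega
    have hstep : ∀ x : ℝ, 0 ≤ x → _ := fun x hx =>
      W_leadPart_succ_add hb hn' (fun x hx => ih hn' hx) hx
    have hlt : (positions b k)[n + 1] < (positions b k)[n] :=
      List.pairwise_iff_getElem.mp (positions_pairwise b k) n (n + 1) hn' hn (by omega)
    have hbR : (b : ℝ) ≠ 0 := by positivity
    have : (1 : ℝ) / b ^ ((positions b k)[n + 1] + 1) =
        ((b ^ ((positions b k)[n] - ((positions b k)[n + 1] + 1)) : ℕ) : ℝ) *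
          (1 / b ^ (positions b k)[n]) := by
      rw [← Nat.add_sub_cancel' (show (positions b k)[n + 1] + 1 ≤ (positions b k)[n] from hlt),
        Nat.add_sub_cancel_left]
      push_cast
      rw [pow_add]
      field_simp
      rw [pow_add, pow_succ]
    rw [this, add_nat_mul_of_add (by positivity) hstep _ hx]

theorem W_leadPart_succ_nat_div (hb : 2 ≤ b) {n k : ℕ} (hn : n < (positions b k).length) (m : ℕ) :
    W b (leadPart b (n + 1) k) (m / b ^ (positions b k)[n]) = 0 := by
  have h := add_nat_mul_of_add (f := W b (leadPart b (n + 1) k))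
    (δ := 1 / b ^ (positions b k)[n]) (by positivity)
    (fun x hx => W_leadPart_succ_add hb hn (fun x hx => W_leadPart_add hb hn hx) hx) m
    (le_refl (0 : ℝ))
  rw [zero_add, mul_one_div] at h
  rw [h, W_leadPart_succ hb hn, intervalIntegral.integral_same]

/-! ### Primitives and integration by parts in one variable -/

theorem mem_drop_lt {b n k i : ℕ} (hn : n < (positions b k).length)
    (hi : i ∈ (positions b k).drop (n + 1)) : i < (positions b k)[n] := by
  have h := (positions_pairwise b k).sublist (List.drop_sublist n _)
  rw [List.drop_eq_getElem_cons hn, List.pairwise_cons] at h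
  exact h.1 i hi

/-- On an elementary interval the integral of `conj wal_{k_{> n}} * W (k_{≤ n})` is the constant
value of `conj wal_{k_{> n + 1}}` times the increment of `W (k_{≤ n + 1})`. -/
theorem integral_wal_mul_W_of_floor (hb : 2 ≤ b) {n k : ℕ} (hn : n < (positions b k).length)
    (m : ℕ) {x : ℝ} (hx : m / b ^ (positions b k)[n] ≤ x)
    (hx' : x ≤ (m + 1 : ℕ) / b ^ (positions b k)[n]) :
    ∫ y in (m / b ^ (positions b k)[n])..x,
        conj (partialWal b k ((positions b k).drop n) y) * W b (leadPart b n k) y =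
      conj (partialWal b k ((positions b k).drop (n + 1)) (m / b ^ (positions b k)[n])) *
        W b (leadPart b (n + 1) k) x := by
  have hU : W b (leadPart b (n + 1) k) x = ∫ y in (m / b ^ (positions b k)[n] : ℝ)..x,
      conj (partialWal b k [(positions b k)[n]] y) * W b (leadPart b n k) y := by
    have h0 := W_leadPart_succ_nat_div hb hn m
    rw [W_leadPart_succ hb hn] at h0 ⊢
    have hint := intervalIntegrable_conj_partialWal_mul_W hb hn.le [(positions b k)[n]]
    rw [← intervalIntegral.integral_add_adjacent_intervals
      (hint 0 (m / b ^ (positions b k)[n])) (hint _ x), h0, zero_add]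
  rw [hU, ← intervalIntegral.integral_const_mul]
  have hb0 : 0 < b := by omega
  have hbR : (0 : ℝ) < (b : ℝ) ^ (positions b k)[n] := by positivity
  refine intervalIntegral.integral_congr_ae ?_
  -- The endpoint `x` may be the next grid point, where the pulled-out factor can jump; it is a null
  -- set.
  have hne : ∀ᵐ y : ℝ, y ≠ x := by
    simp [ae_iff, measure_singleton]
  filter_upwards [hne] with y hyx hy
  rw [uIoc_of_le hx] at hy
  have hy2 : y < x := lt_of_le_of_ne hy.2 hyx
  rw [List.drop_eq_getElem_cons hn, partialWal_cons, map_mul]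
  have : partialWal b k ((positions b k).drop (n + 1)) y =
      partialWal b k ((positions b k).drop (n + 1)) (m / b ^ (positions b k)[n]) := by
    refine partialWal_eq_of_floor_eq hb0 (fun i hi => mem_drop_lt hn hi) ?_
    rw [div_mul_cancel₀ _ hbR.ne', Nat.floor_natCast, Nat.floor_eq_iff]
    · refine ⟨((div_lt_iff₀ hbR).mp hy.1).le, ?_⟩
      have := (lt_div_iff₀ hbR).mp (hy2.trans_le hx')
      exact_mod_cast this
    · exact mul_nonneg ((by positivity : (0 : ℝ) ≤ m / b ^ (positions b k)[n]).trans hy.1.le) hbR.le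
  rw [this]
  ring

/-- The primitive of `conj wal_{k_{> n}} * W (k_{≤ n})` is
`conj wal_{k_{> n + 1}} * W (k_{≤ n + 1})`. -/
theorem integral_wal_mul_W (hb : 2 ≤ b) {n k : ℕ} (hn : n < (positions b k).length) {x : ℝ}
    (hx : 0 ≤ x) :
    ∫ y in (0 : ℝ)..x,
        conj (partialWal b k ((positions b k).drop n) y) * W b (leadPart b n k) y =
      conj (partialWal b k ((positions b k).drop (n + 1)) x) * W b (leadPart b (n + 1) k) x := by
  have hb0 : 0 < b := by omega
  have hbR : (0 : ℝ) < (b : ℝ) ^ (positions b k)[n] := by positivity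
  have hint := intervalIntegrable_conj_partialWal_mul_W hb hn.le ((positions b k).drop n)
  have h0 : ∀ m : ℕ, ∫ y in (0 : ℝ)..(m / b ^ (positions b k)[n]),
      conj (partialWal b k ((positions b k).drop n) y) * W b (leadPart b n k) y = 0 := by
    intro m
    induction m with
    | zero => simp
    | succ m ih =>
      rw [← intervalIntegral.integral_add_adjacent_intervals
        (hint 0 (m / b ^ (positions b k)[n])) (hint _ _), ih, zero_add,
        integral_wal_mul_W_of_floor hb hn m (by gcongr; omega) le_rfl,
        W_leadPart_succ_nat_div hb hn, mul_zero]
  set m := ⌊x * (b : ℝ) ^ (positions b k)[n]⌋₊ with hm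
  have hle : m / (b : ℝ) ^ (positions b k)[n] ≤ x :=
    (div_le_iff₀ hbR).mpr (Nat.floor_le (by positivity))
  have hle' : x ≤ (m + 1 : ℕ) / (b : ℝ) ^ (positions b k)[n] := by
    rw [le_div_iff₀ hbR]
    push_cast
    exact (Nat.lt_floor_add_one _).le
  rw [← intervalIntegral.integral_add_adjacent_intervals
    (hint 0 (m / b ^ (positions b k)[n])) (hint _ x), h0, zero_add,
    integral_wal_mul_W_of_floor hb hn m hle hle']
  congr 2
  refine partialWal_eq_of_floor_eq hb0 (fun i hi => mem_drop_lt hn hi) ?_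
  rw [div_mul_cancel₀ _ hbR.ne', Nat.floor_natCast]

/-- One step of integration by parts in one variable. -/
theorem integral_mul_wal_mul_W (hb : 2 ≤ b) {n k : ℕ} (hn : n < weight b k) {g g' : ℝ → ℝ}
    (hg : ∀ t ∈ Icc (0 : ℝ) 1, HasDerivWithinAt g (g' t) (Icc 0 1) t)
    (hg' : ContinuousOn g' (Icc 0 1)) :
    ∫ t in Ico (0 : ℝ) 1,
        (g t : ℂ) * (conj (wal b (tailPart b n k) t) * W b (leadPart b n k) t) =
      -∫ t in Ico (0 : ℝ) 1, (g' t : ℂ) *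
        (conj (wal b (tailPart b (n + 1) k) t) * W b (leadPart b (n + 1) k) t) := by
  have hn : n < (positions b k).length := hn
  have hb0 : 0 < b := by omega
  simp only [wal_tailPart hb, integral_Ico_eq_integral_Ioc,
    ← intervalIntegral.integral_of_le (zero_le_one (α := ℝ))]
  set G : ℝ → ℂ := fun x => ∫ y in (0 : ℝ)..x,
    conj (partialWal b k ((positions b k).drop n) y) * W b (leadPart b n k) y with hG
  have hint := intervalIntegrable_conj_partialWal_mul_W hb hn.le ((positions b k).drop n)
  have hGc : Continuous G := intervalIntegral.continuous_primitive hint 0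
  -- Only right derivatives are available at the jumps of the Walsh factor, and they suffice for
  -- integration by parts.
  have hGd : ∀ x ∈ Ioo (0 : ℝ) 1, HasDerivWithinAt G
      (conj (partialWal b k ((positions b k).drop n) x) * W b (leadPart b n k) x) (Ioi x) x := by
    intro x hx
    refine (intervalIntegral.integral_hasDerivWithinAt_right (s := Ici x) (t := Ioi x) (hint 0 x)
      ?_ ?_).mono Ioi_subset_Ici_self
    · exact (((measurable_conj_partialWal k _).mul
        (continuous_W_leadPart hb hn.le).measurable).stronglyMeasurable).stronglyMeasurableAtFilter
    · exact (Complex.continuous_conj.continuousAt.comp_continuousWithinAt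
        ((partialWal_continuousWithinAt hb0 k _ hx.1.le).mono Ioi_subset_Ici_self)).mul
        (continuous_W_leadPart hb hn.le).continuousWithinAt
  have hG1 : G 1 = 0 := by
    rw [hG]
    simp only
    rw [integral_wal_mul_W hb hn zero_le_one]
    -- The point `1` is the grid point with numerator `b ^ p`.
    have h := W_leadPart_succ_nat_div hb hn (b ^ (positions b k)[n])
    push_cast at h
    rw [div_self (by positivity)] at h
    rw [h, mul_zero]
  have hG0 : G 0 = 0 := by simp [hG]
  have hu : uIcc (0 : ℝ) 1 = Icc 0 1 := uIcc_of_le zero_le_one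
  have hparts := intervalIntegral.integral_mul_deriv_eq_deriv_mul_of_hasDeriv_right
    (a := 0) (b := 1) (u := fun t => (g t : ℂ)) (u' := fun t => (g' t : ℂ)) (v := G)
    (v' := fun x => conj (partialWal b k ((positions b k).drop n) x) * W b (leadPart b n k) x)
    (by
      rw [hu]
      exact fun t ht => (Complex.continuous_ofReal.continuousAt).comp_continuousWithinAt
        (hg t ht).continuousWithinAt)
    hGc.continuousOn
    (by
      intro x hx
      rw [min_eq_left zero_le_one, max_eq_right zero_le_one] at hx
      exact ((hg x (Ioo_subset_Icc_self hx)).hasDerivAt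
        (Icc_mem_nhds hx.1 hx.2)).ofReal_comp.hasDerivWithinAt)
    (by
      intro x hx
      rw [min_eq_left zero_le_one, max_eq_right zero_le_one] at hx
      exact hGd x hx)
    (by
      refine ContinuousOn.intervalIntegrable ?_
      rw [hu]
      exact Complex.continuous_ofReal.comp_continuousOn hg')
    (hint 0 1)
  rw [hparts, hG1, hG0, mul_zero, mul_zero, sub_zero, zero_sub]
  congr 1
  refine intervalIntegral.integral_congr fun x hx => ?_
  rw [hu] at hx
  simp only [hG]
  rw [integral_wal_mul_W hb hn hx.1]

end

/-! ### Mixed derivatives and Fubini on the cube -/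

theorem mixedDeriv_zero {s : ℕ} (f : (Fin s → ℝ) → ℝ) : mixedDeriv 0 f = f := by
  rw [mixedDeriv]
  induction List.finRange s with
  | nil => rfl
  | cons a l ih => exact ih

/-- The fold applies smaller indices further outside. With no derivatives below `j`, the new one is
outermost, so partial derivatives never have to be interchanged. -/
theorem mixedDeriv_update_succ {s : ℕ} {m : Fin s → ℕ} {j : Fin s} (hm : ∀ i < j, m i = 0)
    (f : (Fin s → ℝ) → ℝ) :
    mixedDeriv (Function.update m j (m j + 1)) f = partialDeriv j (mixedDeriv m f) := by
  have key : ∀ l : List (Fin s), l.Pairwise (· < ·) → j ∈ l →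
      l.foldr (fun i g => (partialDeriv i)^[Function.update m j (m j + 1) i] g) f =
        partialDeriv j (l.foldr (fun i g => (partialDeriv i)^[m i] g) f) := by
    intro l hl hj
    induction l with
    | nil => simp at hj
    | cons a l ih =>
      rw [List.pairwise_cons] at hl
      simp only [List.foldr_cons]
      rcases List.mem_cons.mp hj with rfl | hjl
      · rw [Function.update_self, Function.iterate_succ_apply']
        congr 2
        refine List.foldr_ext _ _ _ fun i hi g => ?_
        rw [Function.update_of_ne (hl.1 i hi).ne']
      · have ha := hl.1 j hjl
        rw [Function.update_of_ne ha.ne, hm a ha, ih hl.2 hjl]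
        rfl
  exact key _ (List.pairwise_lt_finRange s) (List.mem_finRange j)

theorem cube_subset_closedCube (s : ℕ) : cube s ⊆ closedCube s :=
  pi_mono fun _ _ => Ico_subset_Icc_self

theorem measurableSet_cube (s : ℕ) : MeasurableSet (cube s) :=
  MeasurableSet.univ_pi fun _ => measurableSet_Ico

theorem integrableOn_cube_mul {s : ℕ} {g P : (Fin s → ℝ) → ℂ} (hg : ContinuousOn g (closedCube s))
    (hP : Measurable P) {C : ℝ} (hC : ∀ x ∈ cube s, ‖P x‖ ≤ C) :
    IntegrableOn (fun x => g x * P x) (cube s) := by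
  have h1 : IntegrableOn g (cube s) :=
    (hg.integrableOn_compact (isCompact_univ_pi fun _ => isCompact_Icc)).mono_set
      (cube_subset_closedCube s)
  exact h1.mul_bdd hP.aestronglyMeasurable
    ((ae_restrict_iff' (measurableSet_cube s)).mpr (ae_of_all _ hC))

/-- Fubini's theorem on the cube, with the `j`-th variable integrated first. -/
theorem setIntegral_cube_succ {s : ℕ} (j : Fin (s + 1)) {F : (Fin (s + 1) → ℝ) → ℂ}
    (hF : IntegrableOn F (cube (s + 1))) :
    ∫ x in cube (s + 1), F x =
      ∫ y in cube s, ∫ t in Ico (0 : ℝ) 1, F (j.insertNth t y) := by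
  set e := (MeasurableEquiv.piFinSuccAbove (fun _ : Fin (s + 1) => ℝ) j).symm with he
  have hmp : MeasurePreserving e :=
    (volume_preserving_piFinSuccAbove (fun _ : Fin (s + 1) => ℝ) j).symm _
  have happ : ∀ z : ℝ × (Fin s → ℝ), e z = j.insertNth z.1 z.2 := fun z => rfl
  have hpre : e ⁻¹' cube (s + 1) = Ico (0 : ℝ) 1 ×ˢ cube s := by
    ext z
    simp only [mem_preimage, happ, cube, mem_prod, mem_univ_pi, Fin.forall_iff_succAbove j,
      Fin.insertNth_apply_same, Fin.insertNth_apply_succAbove]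
  have hint : IntegrableOn (F ∘ e) (Ico (0 : ℝ) 1 ×ˢ cube s) := by
    rw [← hpre, hmp.integrableOn_comp_preimage e.measurableEmbedding]
    exact hF
  rw [← hmp.setIntegral_preimage_emb e.measurableEmbedding, hpre]
  rw [IntegrableOn, Measure.volume_eq_prod, ← Measure.prod_restrict] at hint
  rw [Measure.volume_eq_prod, ← Measure.prod_restrict]
  exact integral_prod_symm _ hint

/-! ### Integration by parts on the cube -/

section

variable {b : ℕ} [NeZero b]

theorem measurable_conj_wal_mul_W (hb : 2 ≤ b) {n k : ℕ} (hn : n ≤ weight b k) :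
    Measurable fun t => conj (wal b (tailPart b n k) t) * W b (leadPart b n k) t :=
  (measurable_conj_partialWal (tailPart b n k) (positions b (tailPart b n k))).mul
    (continuous_W_leadPart hb hn).measurable

theorem exists_bound_conj_wal_mul_W (hb : 2 ≤ b) {n k : ℕ} (hn : n ≤ weight b k) :
    ∃ C : ℝ, ∀ t ∈ Ico (0 : ℝ) 1,
      ‖conj (wal b (tailPart b n k) t) * W b (leadPart b n k) t‖ ≤ C := by
  obtain ⟨C, hC⟩ := isCompact_Icc.exists_bound_of_continuousOn (s := Icc (0 : ℝ) 1)
    (continuous_W_leadPart hb hn).continuousOn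
  refine ⟨C, fun t ht => ?_⟩
  rw [norm_mul, RCLike.norm_conj, wal_tailPart hb, norm_partialWal, one_mul]
  exact hC t (Ico_subset_Icc_self ht)

variable {s : ℕ} {k α : Fin s → ℕ} {f : (Fin s → ℝ) → ℝ}

theorem integrableOn_mixedDeriv_mul (hb : 2 ≤ b) (hf : HasContMixedDerivs α f) {m : Fin s → ℕ}
    (hmα : ∀ i, m i ≤ α i) (hmk : ∀ i, m i ≤ weight b (k i)) :
    IntegrableOn (fun x => (mixedDeriv m f x : ℂ) *
      ∏ i, (conj (wal b (tailPart b (m i) (k i)) (x i)) * W b (leadPart b (m i) (k i)) (x i)))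
      (cube s) := by
  choose C hC using fun i => exists_bound_conj_wal_mul_W hb (hmk i)
  refine integrableOn_cube_mul (Complex.continuous_ofReal.comp_continuousOn (hf.continuousOn m hmα))
    (Finset.measurable_prod _ fun i _ =>
      (measurable_conj_wal_mul_W hb (hmk i)).comp (measurable_pi_apply i)) (C := ∏ i, C i)
    fun x hx => ?_
  rw [norm_prod]
  exact Finset.prod_le_prod (fun _ _ => norm_nonneg _) fun i _ => hC i _ (hx i (mem_univ i))

/-- One step of integration by parts in the variable `xⱼ`. -/
theorem setIntegral_mixedDeriv_mul (hb : 2 ≤ b) (hf : HasContMixedDerivs α f) {m : Fin s → ℕ}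
    (hmα : ∀ i, m i ≤ α i) (hmk : ∀ i, m i ≤ weight b (k i)) {j : Fin s} (hj : ∀ i < j, m i = 0)
    (hjα : m j < α j) (hjk : m j < weight b (k j)) {m' : Fin s → ℕ}
    (hm' : m' = Function.update m j (m j + 1)) :
    ∫ x in cube s, (mixedDeriv m f x : ℂ) *
        ∏ i, (conj (wal b (tailPart b (m i) (k i)) (x i)) * W b (leadPart b (m i) (k i)) (x i)) =
      -∫ x in cube s, (mixedDeriv m' f x : ℂ) *
        ∏ i, (conj (wal b (tailPart b (m' i) (k i)) (x i)) *
          W b (leadPart b (m' i) (k i)) (x i)) := by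
  have hself : m' j = m j + 1 := by rw [hm', Function.update_self]
  have hother : ∀ i, i ≠ j → m' i = m i := fun i hi => by rw [hm', Function.update_of_ne hi]
  have hle : ∀ c : Fin s → ℕ, (∀ i, m i ≤ c i) → m j < c j → ∀ i, m' i ≤ c i := by
    intro c hc hcj i
    by_cases hi : i = j
    · subst hi
      omega
    · rw [hother i hi]
      exact hc i
  have hm'α := hle α hmα hjα
  have hD : mixedDeriv m' f = partialDeriv j (mixedDeriv m f) := by
    rw [hm', mixedDeriv_update_succ hj]
  obtain _ | s := s
  · exact j.elim0
  rw [setIntegral_cube_succ j (integrableOn_mixedDeriv_mul hb hf hmα hmk),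
    setIntegral_cube_succ j (integrableOn_mixedDeriv_mul hb hf hm'α (hle _ hmk hjk)),
    ← integral_neg]
  refine setIntegral_congr_fun (measurableSet_cube s) fun y hy => ?_
  have hmem : ∀ t ∈ Icc (0 : ℝ) 1, j.insertNth t y ∈ closedCube (s + 1) := by
    intro t ht
    simp only [closedCube, mem_univ_pi, Fin.forall_iff_succAbove j, Fin.insertNth_apply_same,
      Fin.insertNth_apply_succAbove]
    exact ⟨ht, fun i => Ico_subset_Icc_self (hy i (mem_univ i))⟩
  have hcont : Continuous fun t : ℝ => (j.insertNth t y : Fin (s + 1) → ℝ) :=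
    Continuous.finInsertNth (A := fun _ => ℝ) j continuous_id continuous_const
  have h := integral_mul_wal_mul_W hb hjk
    (g := fun t => mixedDeriv m f (j.insertNth t y))
    (g' := fun t => mixedDeriv m' f (j.insertNth t y))
    (fun t ht => by
      have hd := hf.exists_deriv m j hmα hj hjα _ (hmem t ht)
      simp only [Fin.insertNth_apply_same, Fin.update_insertNth] at hd
      rw [hD, partialDeriv]
      simp only [Fin.insertNth_apply_same, Fin.update_insertNth]
      exact hd.hasDerivWithinAt)
    ((hf.continuousOn m' hm'α).comp hcont.continuousOn hmem)
  -- The factors in the other variables agree for `m` and `m'` and are constant in `t`, so they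
  -- leave the inner integral.
  simp only [Fin.prod_univ_succAbove _ j, Fin.insertNth_apply_same, Fin.insertNth_apply_succAbove,
    hself, hother _ (Fin.succAbove_ne j _), ← mul_assoc, integral_mul_const] at h ⊢
  rw [h, neg_mul]

theorem coeff_eq_setIntegral (hb : 2 ≤ b) (hf : HasContMixedDerivs α f) {m : Fin s → ℕ}
    (hm : ∀ i, m i ≤ min (α i) (weight b (k i))) :
    coeff b (fun x => (f x : ℂ)) k =
      (-1) ^ (∑ i, m i) * ∫ x in cube s, (mixedDeriv m f x : ℂ) *
        ∏ i, (conj (wal b (tailPart b (m i) (k i)) (x i)) *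
          W b (leadPart b (m i) (k i)) (x i)) := by
  induction hN : ∑ i, m i generalizing m with
  | zero =>
    obtain rfl : m = 0 := funext fun i => Finset.sum_eq_zero_iff.mp hN i (Finset.mem_univ i)
    simp only [coeff, walMulti, mixedDeriv_zero, Pi.zero_apply, wal_tailPart_zero hb,
      W_leadPart_zero, mul_one, map_prod, pow_zero, one_mul]
  | succ N ih =>
    -- The least such index carries the outermost derivative, which is the one to remove.
    have hex : ∃ j, m j ≠ 0 ∧ ∀ i < j, m i = 0 := by
      have hne : (Finset.univ.filter fun i => m i ≠ 0).Nonempty := by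
        by_contra h
        rw [Finset.not_nonempty_iff_eq_empty, Finset.filter_eq_empty_iff] at h
        rw [Finset.sum_eq_zero fun i hi => not_not.mp (h hi)] at hN
        omega
      refine ⟨_, (Finset.mem_filter.mp (Finset.min'_mem _ hne)).2, fun i hi => ?_⟩
      by_contra h0
      exact absurd (Finset.min'_le _ i (Finset.mem_filter.mpr ⟨Finset.mem_univ i, h0⟩)) 
        (not_le.mpr hi)
    obtain ⟨j, hj0, hj⟩ := hex
    set c := Function.update m j (m j - 1) with hc
    have hcj : c j = m j - 1 := by rw [hc, Function.update_self]
    have hci : ∀ i, i ≠ j → c i = m i := fun i hi => by rw [hc, Function.update_of_ne hi]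
    have hcm : ∀ i, c i ≤ m i := by
      intro i
      by_cases hi : i = j
      · subst hi
        omega
      · exact (hci i hi).le
    have hmc : m = Function.update c j (c j + 1) := by
      rw [hcj, Nat.sub_add_cancel (Nat.pos_of_ne_zero hj0), hc, Function.update_idem,
        Function.update_eq_self]
    have hsum : ∑ i, c i = N := by
      rw [← Finset.add_sum_erase _ _ (Finset.mem_univ j)] at hN ⊢
      rw [Finset.sum_congr rfl fun i hi => hci i (Finset.ne_of_mem_erase hi)]
      change m j + (Finset.univ.erase j).sum m = N + 1 at hN
      omega
    have hjm := hm j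
    rw [ih (fun i => (hcm i).trans (hm i)) hsum,
      setIntegral_mixedDeriv_mul hb hf (fun i => (hcm i).trans ((hm i).trans (min_le_left _ _)))
        (fun i => (hcm i).trans ((hm i).trans (min_le_right _ _)))
        (fun i hi => (hci i hi.ne).trans (hj i hi)) (by omega) (by omega) hmc, pow_succ]
    ring

end

end Walsh

theorem mainTheorem9 (b : ℕ) [NeZero b] (hb : 2 ≤ b) (s : ℕ) (k α n : Fin s → ℕ)
    (f : (Fin s → ℝ) → ℝ) (hf : Walsh.HasContMixedDerivs α f)
    (hn : ∀ j, n j ≤ min (α j) (Walsh.weight b (k j))) :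
    Walsh.coeff b (fun x => (f x : ℂ)) k =
      (-1) ^ (∑ j, n j) *
        ∫ x in Walsh.cube s, (Walsh.mixedDeriv n f x : ℂ) *
          ∏ j, (conj (Walsh.wal b (Walsh.tailPart b (n j) (k j)) (x j)) *
            Walsh.W b (Walsh.leadPart b (n j) (k j)) (x j)) :=
  Walsh.coeff_eq_setIntegral hb hf hn
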